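/- Call a continuous function $\psi:[0,\infty)\to[0,1]$ an (Archimedean) generator if $\psi(0)=1$, $\psi(t)\to0$ as $t\to\infty$, and $\psi$ is strictly decreasing on $[0,\inf\{x:\psi(x)=0\}]$ (with $\inf\emptyset=\infty$ and $\psi(\infty)=0$); $\psi^{-1}$ denotes its inverse on $(0,1]$, and $\psi^{-1}(0)=\inf\{x:\psi(x)=0\}$. A sequence $X_1,X_2,\dots$ of identically distributed random variables with continuous distribution function $F$ is meta-Archimedean with generator $\psi$ if, for every $n\ge2$, the function $$C_n(u_1,\dots,u_n)=\psi\{\psi^{-1}(u_1)+\dots+\psi^{-1}(u_n)\},\qquad u_1,\dots,u_n\in[0,1],$$ is the copula of $(X_1,\dots,X_n)$, i.e. it is a copula and $\mathbb P(X_1\le x_1,\dots,X_n\le x_n)=C_n(F(x_1),\dots,F(x_n))$ for all $x_1,\dots,x_n\in\mathbb R$. For a real sequence $(u_n)$, a strictly stationary sequence $(X_i)$ satisfies the distributional mixing condition $\mathcal D(u_n)$ if there are numbers $\alpha(n,s)$ such that, for all integers $p,q,n\ge1$ and $s\ge 0$ and all indices $1\le i_1<\dots<i_p<j_1<\dots<j_q\le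 n$ with $j_1-i_p\ge s$, writing $A=\{i_1,\dots,i_p\}$ and $B=\{j_1,\dots,j_q\}$, $$\Bigl|\mathbb P\bigl(\max_{i\in A\cup B}X_i\le u_n\bigr)-\mathbb P\bigl(\max_{i\in A}X_i\le u_n\bigr)\,\mathbb P\bigl(\max_{i\in B}X_i\le u_n\bigr)\Bigr|\le\alpha(n,s),$$ and $\alpha(n,s_n)\to0$ as $n\to\infty$ for some sequence of positive integers $s_n=o(n)$. Corollary. Let $(X_i)$ be a meta-Archimedean sequence with generator $\psi$. Suppose that, for some $\rho\in(0,1]$, the function $f(x)=1-\psi(1/x)$, $x>0$, is regularly varying at $\infty$ with index $-\rho$, i.e. $f(tx)/f(x)\to t^{-\rho}$ as $x\to\infty$ for every $t>0$. Let $M_n=\max(X_1,\dots,X_n)$ and suppose that $(c_n)$, $c_n>0$, and $(d_n)$ are real sequences such that $(M_n-d_n)/c_n$ converges in distribution to a nondegenerate limit $G$. Then the condition $\mathcal D(u_n)$ with $u_n=c_nx+d_n$ holds for every $x\in\mathbb R$ if and only if $(X_i)$ is an iid sequence. -/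

import Mathlib

open MeasureTheory ProbabilityTheory Filter Topology Set
open scoped ENNReal

noncomputable section

/-- An Archimedean generator `ψ : [0,∞) → [0,1]`, represented by a function on `ℝ` of which only
the restriction to `[0,∞)` matters. The set in the last field is `[0, inf {x ≥ 0 : ψ x = 0}]`, which
is all of `[0,∞)` if `ψ` has no zero. -/
structure IsArchimedeanGenerator (ψ : ℝ → ℝ) : Prop where
  continuousOn : ContinuousOn ψ (Ici 0)
  mem_Icc : ∀ t, 0 ≤ t → ψ t ∈ Icc (0 : ℝ) 1
  map_zero : ψ 0 = 1
  tendsto_zero : Tendsto ψ atTop (𝓝 0)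
  strictAntiOn : StrictAntiOn ψ {t | 0 ≤ t ∧ ∀ x, 0 ≤ x → ψ x = 0 → t ≤ x}

/-- The extension of a generator to `[0,∞]` by `ψ(∞) = 0`. -/
def generatorExt (ψ : ℝ → ℝ) (t : ℝ≥0∞) : ℝ :=
  if t = ⊤ then 0 else ψ t.toReal

/-- The inverse `ψ⁻¹ : [0,1] → [0,∞]` of a generator. For `u ∈ (0,1]` the set below is a singleton;
for `u = 0` one gets `ψ⁻¹(0) = inf {x : ψ x = 0}`, which is `∞` if `ψ` has no zero. -/
def generatorInv (ψ : ℝ → ℝ) (u : ℝ) : ℝ≥0∞ :=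
  sInf {t : ℝ≥0∞ | generatorExt ψ t = u}

/-- The function `(u₁, …, uₙ) ↦ ψ(ψ⁻¹(u₁) + ⋯ + ψ⁻¹(uₙ))` on `[0,1]ⁿ`. -/
def archimedeanFunction (ψ : ℝ → ℝ) (n : ℕ) (u : Fin n → ℝ) : ℝ :=
  generatorExt ψ (∑ i, generatorInv ψ (u i))

/-- `C` is (on `[0,1]ⁿ`) an `n`-variate copula: the distribution function of a probability measure
all of whose univariate margins are uniform on `[0,1]`. -/
def IsCopula {n : ℕ} (C : (Fin n → ℝ) → ℝ) : Prop :=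
  ∃ ν : Measure (Fin n → ℝ), IsProbabilityMeasure ν ∧
    (∀ i, ν.map (fun x => x i) = volume.restrict (Icc (0 : ℝ) 1)) ∧
    ∀ u : Fin n → ℝ, (∀ i, u i ∈ Icc (0 : ℝ) 1) → C u = ν.real {x | ∀ i, x i ≤ u i}

/-- `C` is a copula of the random vector `(Y₁, …, Yₙ)`: it is a copula and
`ℙ(Y₁ ≤ x₁, …, Yₙ ≤ xₙ) = C(F₁(x₁), …, Fₙ(xₙ))`, where `Fᵢ` is the distribution function of `Yᵢ`.
It is the only one, on `[0,1]ⁿ`, if the `Fᵢ` are continuous. -/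
def IsCopulaOf {Ω : Type*} [MeasurableSpace Ω] (P : Measure Ω) {n : ℕ} (Y : Fin n → Ω → ℝ)
    (C : (Fin n → ℝ) → ℝ) : Prop :=
  IsCopula C ∧ ∀ x : Fin n → ℝ,
    P.real {ω | ∀ i, Y i ω ≤ x i} = C (fun i => cdf (P.map (Y i)) (x i))

/-- `X 0, X 1, …` (the random variables `X₁, X₂, …`) is a meta-Archimedean sequence with
generator `ψ`. -/
structure IsMetaArchimedean {Ω : Type*} [MeasurableSpace Ω] (P : Measure Ω) (X : ℕ → Ω → ℝ)
    (ψ : ℝ → ℝ) : Prop where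
  generator : IsArchimedeanGenerator ψ
  measurable : ∀ i, Measurable (X i)
  identDistrib : ∀ i, IdentDistrib (X i) (X 0) P P
  continuous_cdf : Continuous (cdf (P.map (X 0)))
  copula : ∀ n, 2 ≤ n → IsCopulaOf P (fun i : Fin n => X i) (archimedeanFunction ψ n)

/-- `f > 0` is measurable on `(0,∞)` and regularly varying at `∞` with index `a`. -/
structure IsRegularlyVarying (f : ℝ → ℝ) (a : ℝ) : Prop where
  measurable : Measurable (fun x : Ioi (0 : ℝ) => f x)
  pos : ∀ x, 0 < x → 0 < f x
  tendsto : ∀ t : ℝ, 0 < t → Tendsto (fun x => f (t * x) / f x) atTop (𝓝 (t ^ a))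

/-- `max_{i ∈ A} X_i` for a finite nonempty set `A` of indices (and `0` if `A` is empty). -/
def maxOver {Ω : Type*} (X : ℕ → Ω → ℝ) (A : Finset ℕ) (ω : Ω) : ℝ :=
  if h : A.Nonempty then A.sup' h (fun i => X i ω) else 0

/-- Strict stationarity: the law of the whole sequence is invariant under the shift. -/
def IsStrictlyStationary {Ω : Type*} [MeasurableSpace Ω] (P : Measure Ω) (X : ℕ → Ω → ℝ) : Prop :=
  P.map (fun ω (i : ℕ) => X (i + 1) ω) = P.map (fun ω (i : ℕ) => X i ω)

/-- The distributional mixing condition `𝒟(uₙ)` for a strictly stationary sequence. The index set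
`{1, …, n}` is `Finset.range n`, since the sequence starts at `X 0`. -/
structure DistributionalMixing {Ω : Type*} [MeasurableSpace Ω] (P : Measure Ω) (X : ℕ → Ω → ℝ)
    (u : ℕ → ℝ) : Prop where
  stationary : IsStrictlyStationary P X
  mixing : ∃ (α : ℕ → ℕ → ℝ) (s : ℕ → ℕ),
    (∀ (n l : ℕ) (A B : Finset ℕ), A.Nonempty → B.Nonempty →
      A ⊆ Finset.range n → B ⊆ Finset.range n →
      (∀ i ∈ A, ∀ j ∈ B, i < j ∧ i + l ≤ j) →
      |P.real {ω | maxOver X (A ∪ B) ω ≤ u n}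
        - P.real {ω | maxOver X A ω ≤ u n} * P.real {ω | maxOver X B ω ≤ u n}| ≤ α n l) ∧
    (∀ n, 0 < s n) ∧
    Tendsto (fun n => (s n : ℝ) / (n : ℝ)) atTop (𝓝 0) ∧
    Tendsto (fun n => α n (s n)) atTop (𝓝 0)

/-- Independent and identically distributed. -/
def IsIIDSequence {Ω : Type*} [MeasurableSpace Ω] (P : Measure Ω) (X : ℕ → Ω → ℝ) : Prop :=
  iIndepFun X P ∧ ∀ i, IdentDistrib (X i) (X 0) P P

end

/-! Mixing at one level forces `ψ` to be exponential, which is the generator of the independence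
copula. Pick `x` with `cdf G x = ψ τ` strictly between 0 and 1. Since a maximum over `k` indices at
a level with `F = ψ t` has distribution function `ψ (k * t)`, the levels `u n` satisfy `F (u n) = ψ
(t n)` eventually, with `n * t n → τ`. Applying the mixing bound to two separated blocks of about `n
/ m` indices and letting `n → ∞` yields `ψ (2τ/m) = ψ (τ/m) ^ 2` for all `m ≥ 3`
(`generator_two_mul_div`).

This says only that the events `X i ≤ y`, with `F y = ψ (τ/m)`, are pairwise uncorrelated. But there
are infinitely many of them, so their averages converge in L² to a constant; an event having the
same joint probability with all later ones must then be uncorrelated with them. By induction `ψ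
(kτ/m) = ψ (τ/m) ^ k` (`generator_natCast_mul`), and continuity extends this to an exponential on
`[0,∞)`, so the joint distribution functions factor.

Conversely, for an iid sequence the mixing difference is exactly zero. -/

/-! ### Second moments of sums of indicators with constant pairwise correlation -/

section PairwiseUncorrelated

variable {Ω : Type*} [MeasurableSpace Ω] {P : Measure Ω} [IsProbabilityMeasure P]
  {E : ℕ → Set Ω} {p q : ℝ}

/-- The quadratic term carries the off-diagonal covariance `q - p ^ 2`: it makes the variance
negative for large `J` if `q < p ^ 2`, and leaves only linear growth if `q = p ^ 2`. -/
theorem integral_sq_sum_centered_indicator (hE : ∀ i, MeasurableSet (E i))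
    (hp : ∀ i, P.real (E i) = p) (hq : ∀ i j, i ≠ j → P.real (E i ∩ E j) = q) (J : Finset ℕ) :
    Integrable (fun ω => (∑ j ∈ J, ((E j).indicator 1 ω - p)) ^ 2) P ∧
    ∫ ω, (∑ j ∈ J, ((E j).indicator 1 ω - p)) ^ 2 ∂P =
      (J.card : ℝ) ^ 2 * (q - p ^ 2) + J.card * (p - q) := by
  have hint : ∀ A : Set Ω, MeasurableSet A → Integrable (A.indicator (1 : Ω → ℝ)) P :=
    fun A hA => (integrable_const (1 : ℝ)).indicator hA
  have hprod : ∀ i j : ℕ, (fun ω => ((E i).indicator (1 : Ω → ℝ) ω - p) *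
      ((E j).indicator 1 ω - p)) = fun ω => (E i ∩ E j).indicator (1 : Ω → ℝ) ω
        - p * (E i).indicator 1 ω - p * (E j).indicator 1 ω + p ^ 2 := by
    intro i j
    funext ω
    rw [inter_indicator_one]
    simp only [Pi.mul_apply]
    ring
  have hI : ∀ i j : ℕ, Integrable (fun ω => ((E i).indicator (1 : Ω → ℝ) ω - p) *
      ((E j).indicator 1 ω - p)) P := by
    intro i j
    rw [hprod]
    exact (((hint _ ((hE i).inter (hE j))).sub ((hint _ (hE i)).const_mul p)).sub
      ((hint _ (hE j)).const_mul p)).add (integrable_const _)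
  have hval : ∀ i j : ℕ, ∫ ω, ((E i).indicator (1 : Ω → ℝ) ω - p) *
      ((E j).indicator 1 ω - p) ∂P = (q - p ^ 2) + if i = j then p - q else 0 := by
    intro i j
    rw [hprod]
    have h1 := hint _ ((hE i).inter (hE j))
    have h2 := (hint _ (hE i)).const_mul p
    have h3 := (hint _ (hE j)).const_mul p
    have h12 : Integrable (fun ω => (E i ∩ E j).indicator (1 : Ω → ℝ) ω
        - p * (E i).indicator 1 ω) P := h1.sub h2
    have h123 : Integrable (fun ω => (E i ∩ E j).indicator (1 : Ω → ℝ) ω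
        - p * (E i).indicator 1 ω - p * (E j).indicator 1 ω) P := h12.sub h3
    rw [integral_add h123 (integrable_const _), integral_sub h12 h3,
      integral_sub h1 h2, integral_const_mul, integral_const_mul,
      integral_indicator_one ((hE i).inter (hE j)), integral_indicator_one (hE i),
      integral_indicator_one (hE j), hp, hp]
    by_cases h : i = j
    · subst h
      simp [hp]
      ring
    · simp [h, hq i j h]
      ring
  have hexp : (fun ω => (∑ j ∈ J, ((E j).indicator (1 : Ω → ℝ) ω - p)) ^ 2) =
      fun ω => ∑ i ∈ J, ∑ j ∈ J, ((E i).indicator (1 : Ω → ℝ) ω - p) *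
        ((E j).indicator 1 ω - p) := by
    funext ω
    rw [sq, Finset.sum_mul_sum]
  rw [hexp]
  refine ⟨integrable_finsetSum _ fun i _ => integrable_finsetSum _ fun j _ => hI i j, ?_⟩
  rw [integral_finsetSum _ fun i _ => integrable_finsetSum _ fun j _ => hI i j]
  simp_rw [integral_finsetSum _ fun j _ => hI _ j, hval, Finset.sum_add_distrib]
  simp
  ring

/-- Infinitely many events with common probability cannot be pairwise negatively correlated by
a fixed amount. -/
theorem sq_le_of_pairwise_inter (hE : ∀ i, MeasurableSet (E i))
    (hp : ∀ i, P.real (E i) = p) (hq : ∀ i j, i ≠ j → P.real (E i ∩ E j) = q) : p ^ 2 ≤ q := by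
  by_contra! h
  -- Beyond this threshold the variance `N ^ 2 * (q - p ^ 2) + N * (p - q)` would be negative.
  obtain ⟨N, hN⟩ := exists_nat_gt ((p - q) / (p ^ 2 - q))
  rw [div_lt_iff₀ (by linarith)] at hN
  have hpq : q ≤ p := by
    rw [← hp 0, ← hq 0 1 (by simp)]
    exact measureReal_mono inter_subset_left
  have hN0 : (0 : ℝ) < N := by
    by_contra! h0
    nlinarith
  have h1 := (integral_sq_sum_centered_indicator hE hp hq (Finset.range N)).2
  have h2 : 0 ≤ ∫ ω, (∑ j ∈ Finset.range N, ((E j).indicator 1 ω - p)) ^ 2 ∂P :=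
    integral_nonneg fun ω => sq_nonneg _
  rw [h1, Finset.card_range] at h2
  nlinarith

/-- An event whose correlation with infinitely many pairwise uncorrelated events is constant is
uncorrelated with them. -/
theorem measureReal_inter_eq_of_pairwise_uncorrelated (hE : ∀ i, MeasurableSet (E i))
    (hp : ∀ i, P.real (E i) = p) (hq : ∀ i j, i ≠ j → P.real (E i ∩ E j) = p ^ 2)
    {H : Set Ω} (hH : MeasurableSet H) {k : ℕ} {r : ℝ}
    (hr : ∀ j, k ≤ j → P.real (H ∩ E j) = r) : r = p * P.real H := by
  -- `c` is the common covariance of `H` with `E j`, `j ≥ k`.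
  set c := r - p * P.real H with hc
  suffices c = 0 by linarith
  have hint : ∀ A : Set Ω, MeasurableSet A → Integrable (A.indicator (1 : Ω → ℝ)) P :=
    fun A hA => (integrable_const (1 : ℝ)).indicator hA
  have hHE : ∀ j, (fun ω => H.indicator (1 : Ω → ℝ) ω * ((E j).indicator 1 ω - p)) =
      fun ω => (H ∩ E j).indicator (1 : Ω → ℝ) ω - p * H.indicator 1 ω := by
    intro j
    funext ω
    rw [inter_indicator_one]
    simp only [Pi.mul_apply]
    ring
  have hI : ∀ j, Integrable
      (fun ω => H.indicator (1 : Ω → ℝ) ω * ((E j).indicator 1 ω - p)) P := by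
    intro j
    rw [hHE]
    exact (hint _ (hH.inter (hE j))).sub ((hint _ hH).const_mul p)
  have hval : ∀ j, k ≤ j →
      ∫ ω, H.indicator (1 : Ω → ℝ) ω * ((E j).indicator 1 ω - p) ∂P = c := by
    intro j hj
    rw [hHE, integral_sub (hint _ (hH.inter (hE j))) ((hint _ hH).const_mul p),
      integral_const_mul, integral_indicator_one (hH.inter (hE j)), integral_indicator_one hH,
      hr j hj]
  have key : ∀ N : ℕ, (N : ℝ) ^ 2 * c ^ 2 ≤ N * (p - p ^ 2) := by
    intro N
    obtain ⟨hSi, hS⟩ := integral_sq_sum_centered_indicator hE hp hq (Finset.Ico k (k + N))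
    set S : Ω → ℝ := fun ω => ∑ j ∈ Finset.Ico k (k + N), ((E j).indicator 1 ω - p) with hSdef
    have hHS : (fun ω => H.indicator (1 : Ω → ℝ) ω * S ω) = fun ω =>
        ∑ j ∈ Finset.Ico k (k + N), H.indicator (1 : Ω → ℝ) ω * ((E j).indicator 1 ω - p) := by
      funext ω
      rw [hSdef, Finset.mul_sum]
    have hHSi : Integrable (fun ω => H.indicator (1 : Ω → ℝ) ω * S ω) P := by
      rw [hHS]
      exact integrable_finsetSum _ fun j _ => hI j
    have hHSv : ∫ ω, H.indicator (1 : Ω → ℝ) ω * S ω ∂P = N * c := by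
      rw [hHS, integral_finsetSum _ fun j _ => hI j,
        Finset.sum_congr rfl fun j hj => hval j (Finset.mem_Ico.1 hj).1]
      simp
    -- The integrand is `(S - N * c) ^ 2` on `H` and a sum of squares off `H`. Its integral is `N *
    -- (p - p ^ 2) - 2 * (N * c) ^ 2 + (N * c) ^ 2`.
    have hle : 0 ≤ ∫ ω, (S ω ^ 2 - 2 * (N * c) * (H.indicator (1 : Ω → ℝ) ω * S ω)
        + (N * c) ^ 2) ∂P := by
      refine integral_nonneg fun ω => ?_
      by_cases h : ω ∈ H
      · simp only [Pi.zero_apply, h, indicator_of_mem, Pi.one_apply]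
        nlinarith [sq_nonneg (S ω - N * c)]
      · simp only [Pi.zero_apply, h, not_false_eq_true, indicator_of_notMem]
        nlinarith [sq_nonneg (S ω), sq_nonneg (N * c)]
    have hSi' : Integrable (fun ω => S ω ^ 2) P := hSi
    have hdiff : Integrable (fun ω => S ω ^ 2
        - 2 * (N * c) * (H.indicator (1 : Ω → ℝ) ω * S ω)) P := hSi'.sub (hHSi.const_mul _)
    rw [integral_add hdiff (integrable_const _), integral_sub hSi' (hHSi.const_mul _),
      integral_const_mul, hHSv, hS] at hle
    simp at hle
    nlinarith
  by_contra hne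
  have hc2 : 0 < c ^ 2 := by positivity
  obtain ⟨N, hN⟩ := exists_nat_gt ((p - p ^ 2) / c ^ 2)
  rw [div_lt_iff₀ hc2] at hN
  have h1 := key (N + 1)
  push_cast at h1
  nlinarith [key 1, Nat.cast_nonneg (α := ℝ) N]

end PairwiseUncorrelated

/-! ### Generators and their inverses -/

section Generator

variable {ψ : ℝ → ℝ}

/-- The interval `[0, inf {x ≥ 0 : ψ x = 0}]` on which a generator is strictly decreasing. -/
def generatorSupport (ψ : ℝ → ℝ) : Set ℝ := {t | 0 ≤ t ∧ ∀ x, 0 ≤ x → ψ x = 0 → t ≤ x}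

theorem mem_generatorSupport_of_le {s t : ℝ} (hs : 0 ≤ s) (hst : s ≤ t)
    (ht : t ∈ generatorSupport ψ) : s ∈ generatorSupport ψ :=
  ⟨hs, fun x hx h => hst.trans (ht.2 x hx h)⟩

theorem zero_mem_generatorSupport : (0 : ℝ) ∈ generatorSupport ψ := ⟨le_rfl, fun _ hx _ => hx⟩

namespace IsArchimedeanGenerator

theorem generatorInv_apply (hψ : IsArchimedeanGenerator ψ) {t : ℝ}
    (ht : t ∈ generatorSupport ψ) :
    generatorInv ψ (ψ t) = ENNReal.ofReal t := by
  apply le_antisymm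
  · exact sInf_le (by simp [generatorExt, ENNReal.toReal_ofReal ht.1])
  · refine le_sInf fun s hs => ?_
    by_cases hst : s = ⊤
    · simp [hst]
    · have hs' : ψ s.toReal = ψ t := by simpa [generatorExt, hst] using hs
      rw [← ENNReal.ofReal_toReal hst]
      refine ENNReal.ofReal_le_ofReal ?_
      by_contra! hlt
      exact absurd hs' (hψ.strictAntiOn
        (mem_generatorSupport_of_le ENNReal.toReal_nonneg hlt.le ht) ht hlt).ne'

theorem exists_pos_mem_generatorSupport (hψ : IsArchimedeanGenerator ψ) :
    ∃ ε ∈ generatorSupport ψ, 0 < ε ∧ 0 < ψ ε := by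
  have h0 : ∀ᶠ t in 𝓝[≥] (0 : ℝ), 0 < ψ t :=
    (hψ.continuousOn 0 (mem_Ici.2 le_rfl)).eventually
      (lt_mem_nhds (by rw [hψ.map_zero]; exact one_pos))
  obtain ⟨ε, hε, h⟩ := (mem_nhdsGE_iff_exists_Ico_subset).1 h0
  have hε0 : (0 : ℝ) < ε := hε
  -- Positivity is known only on `[0, ε)`, hence the halving.
  have hmem : ε / 2 ∈ generatorSupport ψ := by
    refine ⟨by positivity, fun x hx hx0 => ?_⟩
    by_contra! hlt
    have : 0 < ψ x := h ⟨hx, by linarith⟩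
    exact this.ne' hx0
  exact ⟨ε / 2, hmem, by positivity, h ⟨by positivity, by linarith⟩⟩

theorem lt_one (hψ : IsArchimedeanGenerator ψ) {t : ℝ} (ht : t ∈ generatorSupport ψ)
    (h0 : 0 < t) : ψ t < 1 := by
  rw [← hψ.map_zero]
  exact hψ.strictAntiOn zero_mem_generatorSupport ht h0

/-- The smallest zero of a generator that has one. -/
theorem exists_first_zero (hψ : IsArchimedeanGenerator ψ) {x : ℝ} (hx : 0 ≤ x) (h : ψ x = 0) :
    ∃ z ∈ generatorSupport ψ, 0 < z ∧ ψ z = 0 := by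
  have hcl : IsClosed (Ici (0 : ℝ) ∩ ψ ⁻¹' {0}) :=
    hψ.continuousOn.preimage_isClosed_of_isClosed isClosed_Ici isClosed_singleton
  have hbd : BddBelow (Ici (0 : ℝ) ∩ ψ ⁻¹' {0}) := ⟨0, fun y hy => hy.1⟩
  have hm := hcl.csInf_mem ⟨x, hx, h⟩ hbd
  refine ⟨_, ⟨hm.1, fun y hy hy0 => csInf_le hbd ⟨hy, hy0⟩⟩, lt_of_le_of_ne hm.1 ?_, hm.2⟩
  intro h0
  have := hm.2
  rw [← h0, mem_preimage, hψ.map_zero] at this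
  simp at this

/-- A generator attains every value in `(0,1]`. -/
theorem exists_eq (hψ : IsArchimedeanGenerator ψ) {u : ℝ} (hu0 : 0 < u) (hu1 : u ≤ 1) :
    ∃ t, 0 ≤ t ∧ ψ t = u := by
  obtain ⟨b, hb, hb0⟩ := ((hψ.tendsto_zero.eventually (gt_mem_nhds hu0)).and
    (eventually_ge_atTop 0)).exists
  obtain ⟨t, ht, h⟩ := intermediate_value_Icc' hb0
    (hψ.continuousOn.mono Icc_subset_Ici_self) ⟨hb.le, by rw [hψ.map_zero]; exact hu1⟩
  exact ⟨t, ht.1, h⟩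

end IsArchimedeanGenerator

end Generator

theorem setOf_maxOver_le {Ω : Type*} {X : ℕ → Ω → ℝ} {A : Finset ℕ}
    (hA : A.Nonempty) (u : ℝ) : {ω | maxOver X A ω ≤ u} = {ω | ∀ i ∈ A, X i ω ≤ u} := by
  ext ω
  simp [maxOver, hA]

/-! ### Finite-dimensional distributions and multiplicative generators -/

namespace IsMetaArchimedean

variable {Ω : Type*} [MeasurableSpace Ω] {P : Measure Ω}
  {X : ℕ → Ω → ℝ} {ψ : ℝ → ℝ}

theorem measurableSet_forall_le (hX : IsMetaArchimedean P X ψ) (A : Finset ℕ) (y : ℕ → ℝ) :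
    MeasurableSet {ω | ∀ i ∈ A, X i ω ≤ y i} := by
  have : {ω | ∀ i ∈ A, X i ω ≤ y i} = ⋂ i ∈ A, X i ⁻¹' Iic (y i) := by
    ext ω
    simp
  rw [this]
  exact Finset.measurableSet_biInter _ fun i _ => hX.measurable i measurableSet_Iic

theorem map_eq (hX : IsMetaArchimedean P X ψ) (i : ℕ) : P.map (X i) = P.map (X 0) :=
  (hX.identDistrib i).map_eq

theorem measureReal_le [IsProbabilityMeasure P] (hX : IsMetaArchimedean P X ψ) (i : ℕ) (y : ℝ) :
    P.real {ω | X i ω ≤ y} = cdf (P.map (X 0)) y := by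
  have := Measure.isProbabilityMeasure_map (μ := P) (hX.measurable i).aemeasurable
  rw [← hX.map_eq i, cdf_eq_real, map_measureReal_apply (hX.measurable i) measurableSet_Iic]
  rfl

theorem exists_cdf_eq (hX : IsMetaArchimedean P X ψ) {u : ℝ} (hu0 : 0 < u) (hu1 : u < 1) :
    ∃ y, cdf (P.map (X 0)) y = u := by
  obtain ⟨a, ha⟩ := ((tendsto_cdf_atBot (P.map (X 0))).eventually (gt_mem_nhds hu0)).exists
  obtain ⟨b, hb⟩ := ((tendsto_cdf_atTop (P.map (X 0))).eventually (lt_mem_nhds hu1)).exists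
  exact mem_range_of_exists_le_of_exists_ge hX.continuous_cdf ⟨a, ha.le⟩ ⟨b, hb.le⟩

theorem measureReal_forall_fin_le (hX : IsMetaArchimedean P X ψ) {n : ℕ} (hn : 2 ≤ n)
    {y t : Fin n → ℝ} (ht : ∀ i, t i ∈ generatorSupport ψ)
    (hy : ∀ i, cdf (P.map (X 0)) (y i) = ψ (t i)) :
    P.real {ω | ∀ i : Fin n, X i ω ≤ y i} = ψ (∑ i, t i) := by
  rw [(hX.copula n hn).2 y, archimedeanFunction]
  have : ∀ i : Fin n, generatorInv ψ (cdf (P.map (X i)) (y i)) = ENNReal.ofReal (t i) := by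
    intro i
    rw [hX.map_eq, hy, hX.generator.generatorInv_apply (ht i)]
  simp_rw [this]
  rw [← ENNReal.ofReal_sum_of_nonneg fun i _ => (ht i).1, generatorExt,
    if_neg ENNReal.ofReal_ne_top,
    ENNReal.toReal_ofReal (Finset.sum_nonneg fun i _ => (ht i).1)]

/-- The finite-dimensional distributions over arbitrary finite sets of indices. -/
theorem measureReal_forall_le [IsProbabilityMeasure P]
    (hX : IsMetaArchimedean P X ψ) (A : Finset ℕ) {y t : ℕ → ℝ}
    (ht : ∀ i ∈ A, t i ∈ generatorSupport ψ)
    (hy : ∀ i ∈ A, cdf (P.map (X 0)) (y i) = ψ (t i)) :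
    P.real {ω | ∀ i ∈ A, X i ω ≤ y i} = ψ (∑ i ∈ A, t i) := by
  obtain ⟨m, hm⟩ := A.exists_nat_subset_range
  -- The copula formula is available only for dimension at least 2.
  set n := m + 2
  have hAn : A ⊆ Finset.range n := hm.trans (Finset.range_mono (by omega))
  set T := ∑ i ∈ A, t i with hT
  have hT0 : 0 ≤ T := Finset.sum_nonneg fun i hi => (ht i hi).1
  set k := (Finset.range n \ A).card with hk
  obtain ⟨ε₀, hε₀, hε₀0, hε₀ψ⟩ := hX.generator.exists_pos_mem_generatorSupport
  -- `F` need not attain 1, so the `k` unwanted coordinates are bounded by a level `z` with `F z = ψ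
  -- ε`. By the union bound this costs at most `k * (1 - ψ ε)`, which vanishes as `ε → 0`.
  have key : ∀ ε ∈ Ioc 0 ε₀, |P.real {ω | ∀ i ∈ A, X i ω ≤ y i} - ψ (T + k * ε)|
      ≤ k * (1 - ψ ε) := by
    intro ε hε
    have hεS : ε ∈ generatorSupport ψ := mem_generatorSupport_of_le hε.1.le hε.2 hε₀
    have hεpos : 0 < ψ ε := hε₀ψ.trans_le (hX.generator.strictAntiOn.antitoneOn hεS hε₀ hε.2)
    obtain ⟨z, hz⟩ := hX.exists_cdf_eq hεpos (hX.generator.lt_one hεS hε.1)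
    have hjoint := hX.measureReal_forall_fin_le (n := n) (by omega)
      (y := fun i => if (i : ℕ) ∈ A then y i else z) (t := fun i => if (i : ℕ) ∈ A then t i else ε)
      (fun i => by split_ifs with h; exacts [ht _ h, hεS])
      (fun i => by split_ifs with h; exacts [hy _ h, hz])
    have hsum : ∑ i : Fin n, (if (i : ℕ) ∈ A then t i else ε) = T + k * ε := by
      rw [Fin.sum_univ_eq_sum_range (fun i => if i ∈ A then t i else ε) n,
        ← Finset.sum_sdiff hAn, add_comm]
      congr 1
      · exact Finset.sum_congr rfl fun i hi => if_pos hi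
      · rw [Finset.sum_congr rfl fun i hi => if_neg (Finset.mem_sdiff.1 hi).2]
        simp [hk]
    have hset : {ω | ∀ i : Fin n, X i ω ≤ if (i : ℕ) ∈ A then y i else z} =
        {ω | ∀ i ∈ A, X i ω ≤ y i} \ ⋃ i ∈ Finset.range n \ A, {ω | X i ω ≤ z}ᶜ := by
      ext ω
      simp only [mem_ofPred_eq, Set.mem_sdiff, mem_iUnion, mem_compl_iff, not_exists, not_not,
        Finset.mem_sdiff, Finset.mem_range]
      constructor
      · intro h
        refine ⟨fun i hi => ?_, fun i hi => ?_⟩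
        · simpa [hi] using h ⟨i, Finset.mem_range.1 (hAn hi)⟩
        · simpa [hi.2] using h ⟨i, hi.1⟩
      · rintro ⟨h1, h2⟩ i
        split_ifs with hi
        · exact h1 _ hi
        · exact h2 _ ⟨i.2, hi⟩
    rw [hsum, hset] at hjoint
    have hbound : P.real (⋃ i ∈ Finset.range n \ A, {ω | X i ω ≤ z}ᶜ) ≤ k * (1 - ψ ε) := by
      refine (measureReal_biUnion_finset_le _ _).trans_eq ?_
      rw [Finset.sum_congr rfl fun i _ => show P.real {ω | X i ω ≤ z}ᶜ = 1 - ψ ε by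
        rw [probReal_compl_eq_one_sub (measurableSet_le (hX.measurable i) measurable_const),
          hX.measureReal_le, hz]]
      rw [Finset.sum_const, nsmul_eq_mul]
    rw [← hjoint, abs_sub_le_iff]
    have h1 := le_measureReal_sdiff (μ := P) (s₁ := {ω | ∀ i ∈ A, X i ω ≤ y i})
      (s₂ := ⋃ i ∈ Finset.range n \ A, {ω | X i ω ≤ z}ᶜ) (measure_ne_top _ _)
    have h2 : P.real ({ω | ∀ i ∈ A, X i ω ≤ y i} \ ⋃ i ∈ Finset.range n \ A, {ω | X i ω ≤ z}ᶜ)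
        ≤ P.real {ω | ∀ i ∈ A, X i ω ≤ y i} := measureReal_mono Set.sdiff_subset
    have h3 : 0 ≤ P.real (⋃ i ∈ Finset.range n \ A, {ω | X i ω ≤ z}ᶜ) := measureReal_nonneg
    constructor <;> linarith
  have hlim0 : Tendsto ψ (𝓝[>] 0) (𝓝 1) := by
    rw [← hX.generator.map_zero]
    exact (hX.generator.continuousOn 0 (mem_Ici.2 le_rfl)).mono_left
      (nhdsWithin_mono _ Ioi_subset_Ici_self)
  have hlimT : Tendsto (fun ε : ℝ => ψ (T + k * ε)) (𝓝[>] 0) (𝓝 (ψ T)) := by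
    refine (hX.generator.continuousOn T hT0).tendsto.comp
      (tendsto_nhdsWithin_iff.2 ⟨?_, ?_⟩)
    · have : Tendsto (fun ε : ℝ => T + k * ε) (𝓝 0) (𝓝 (T + k * 0)) :=
        (by fun_prop : Continuous fun ε : ℝ => T + k * ε).tendsto 0
      rw [mul_zero, add_zero] at this
      exact this.mono_left nhdsWithin_le_nhds
    · filter_upwards [self_mem_nhdsWithin] with ε hε
      have : (0 : ℝ) < ε := hε
      exact mem_Ici.2 (by positivity)
  have hle := le_of_tendsto_of_tendsto (tendsto_const_nhds.sub hlimT).abs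
    ((tendsto_const_nhds.sub hlim0).const_mul (k : ℝ))
    (by filter_upwards [Ioc_mem_nhdsGT hε₀0] with ε hε using key ε hε)
  rw [sub_self, mul_zero] at hle
  linarith [abs_nonpos_iff.1 hle]

/-- The generator of an infinite meta-Archimedean sequence has no zero. -/
theorem generator_pos [IsProbabilityMeasure P]
    (hX : IsMetaArchimedean P X ψ) {x : ℝ} (hx : 0 ≤ x) : 0 < ψ x := by
  refine lt_of_le_of_ne (hX.generator.mem_Icc x hx).1 fun h => ?_
  obtain ⟨z, hz, hz0, hψz⟩ := hX.generator.exists_first_zero hx h.symm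
  have hhalf : z / 2 ∈ generatorSupport ψ :=
    mem_generatorSupport_of_le (by positivity) (by linarith) hz
  have hpos : 0 < ψ (z / 2) := by
    rw [← hψz]
    exact hX.generator.strictAntiOn hhalf hz (by linarith)
  obtain ⟨y, hy⟩ := hX.exists_cdf_eq hpos (hX.generator.lt_one hhalf (by positivity))
  -- A first zero `z` would make these events, each of probability `ψ (z / 2) > 0`, pairwise almost
  -- surely disjoint.
  have hle := sq_le_of_pairwise_inter (P := P) (E := fun i => {ω | X i ω ≤ y})
    (p := ψ (z / 2)) (q := 0)
    (fun i => hX.measurable i measurableSet_Iic) (fun i => by rw [hX.measureReal_le, hy])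
    (fun i j hij => by
      have := hX.measureReal_forall_le {i, j} (y := fun _ => y) (t := fun _ => z / 2)
        (fun _ _ => hhalf) (fun _ _ => hy)
      rw [Finset.sum_pair hij, add_halves, hψz] at this
      rw [← this]
      congr 1
      ext ω
      simp)
  nlinarith

theorem generatorSupport_eq [IsProbabilityMeasure P]
    (hX : IsMetaArchimedean P X ψ) : generatorSupport ψ = Ici 0 := by
  ext t
  exact ⟨fun h => h.1, fun h => ⟨h, fun x hx h0 => absurd h0 (hX.generator_pos hx).ne'⟩⟩

theorem strictAntiOn [IsProbabilityMeasure P]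
    (hX : IsMetaArchimedean P X ψ) : StrictAntiOn ψ (Ici 0) := by
  rw [← hX.generatorSupport_eq]
  exact hX.generator.strictAntiOn

theorem measureReal_forall_le_const [IsProbabilityMeasure P]
    (hX : IsMetaArchimedean P X ψ) (A : Finset ℕ) {y t : ℝ}
    (ht : 0 ≤ t) (hy : cdf (P.map (X 0)) y = ψ t) :
    P.real {ω | ∀ i ∈ A, X i ω ≤ y} = ψ (A.card * t) := by
  have := hX.measureReal_forall_le A (y := fun _ => y) (t := fun _ => t)
    (fun _ _ => by rw [hX.generatorSupport_eq]; exact ht) (fun _ _ => hy)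
  simpa using this

/-- Pairwise lack of correlation bootstraps to all orders: the event that the first `k` variables
stay below the level meets each later such event with probability `ψ ((k + 1) * δ)`, independent of
which one, and so is uncorrelated with it. -/
theorem generator_natCast_mul [IsProbabilityMeasure P] (hX : IsMetaArchimedean P X ψ) {δ : ℝ} (hδ : 0 < δ)
    (h : ψ (2 * δ) = ψ δ ^ 2) (k : ℕ) : ψ (k * δ) = ψ δ ^ k := by
  have hδS : δ ∈ generatorSupport ψ := by
    rw [hX.generatorSupport_eq]
    exact hδ.le
  obtain ⟨y, hy⟩ := hX.exists_cdf_eq (hX.generator_pos hδ.le) (hX.generator.lt_one hδS hδ)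
  induction k with
  | zero => simp [hX.generator.map_zero]
  | succ k ih =>
    have key := measureReal_inter_eq_of_pairwise_uncorrelated (P := P)
      (E := fun i => {ω | X i ω ≤ y}) (p := ψ δ)
      (fun i => hX.measurable i measurableSet_Iic) (fun i => by rw [hX.measureReal_le, hy])
      (fun i j hij => by
        have := hX.measureReal_forall_le_const {i, j} hδ.le hy
        rw [Finset.card_pair hij, Nat.cast_two, h] at this
        rw [← this]
        congr 1
        ext ω
        simp)
      (hX.measurableSet_forall_le (Finset.range k) fun _ => y) (k := k)
      (r := ψ ((k + 1 : ℕ) * δ)) (fun j hj => by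
        have := hX.measureReal_forall_le_const (insert j (Finset.range k)) hδ.le hy
        rw [Finset.card_insert_of_notMem (by simpa using hj), Finset.card_range] at this
        rw [← this]
        congr 1
        ext ω
        simp [and_comm])
    rw [key, hX.measureReal_forall_le_const _ hδ.le hy, Finset.card_range, ih, pow_succ']

/-- A multiplicative generator gives independent variables. -/
theorem iIndepFun_of_generator_eq [IsProbabilityMeasure P] (hX : IsMetaArchimedean P X ψ) {a : ℝ} (ha : 0 < a)
    (h : ∀ t, 0 ≤ t → ψ t = a ^ t) : iIndepFun X P := by
  have hIic : ∀ (s : Finset ℕ) (y : ℕ → ℝ), P (⋂ i ∈ s, X i ⁻¹' Iic (y i)) =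
      ∏ i ∈ s, P (X i ⁻¹' Iic (y i)) := by
    intro s y
    -- The value 0 is not attained by `ψ`; there both sides vanish. Otherwise each `F (y i)` is some
    -- `ψ (t i)`, and the exponential turns the sum into a product.
    by_cases h0 : ∃ i ∈ s, P.real {ω | X i ω ≤ y i} = 0
    · obtain ⟨i, hi, hi0⟩ := h0
      rw [measureReal_eq_zero_iff] at hi0
      rw [Finset.prod_eq_zero hi hi0]
      exact measure_mono_null (biInter_subset_of_mem hi) hi0
    · push Not at h0
      have hex : ∀ i, ∃ t, i ∈ s → 0 ≤ t ∧ ψ t = cdf (P.map (X 0)) (y i) := by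
        intro i
        by_cases hi : i ∈ s
        · have := h0 i hi
          rw [hX.measureReal_le] at this
          obtain ⟨t, ht⟩ := hX.generator.exists_eq
            (lt_of_le_of_ne (cdf_nonneg _ _) this.symm) (cdf_le_one _ _)
          exact ⟨t, fun _ => ht⟩
        · exact ⟨0, fun h => absurd h hi⟩
      choose t ht using hex
      have hmain := hX.measureReal_forall_le s (y := y) (t := t)
        (fun i hi => by rw [hX.generatorSupport_eq]; exact (ht i hi).1)
        (fun i hi => (ht i hi).2.symm)
      rw [h _ (Finset.sum_nonneg fun i hi => (ht i hi).1), Real.rpow_sum_of_pos ha,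
        Finset.prod_congr rfl fun i hi => show a ^ t i = P.real {ω | X i ω ≤ y i} by
          rw [hX.measureReal_le, ← (ht i hi).2, h _ (ht i hi).1]] at hmain
      have hset : {ω | ∀ i ∈ s, X i ω ≤ y i} = ⋂ i ∈ s, X i ⁻¹' Iic (y i) := by
        ext ω
        simp
      rw [hset] at hmain
      rw [← ENNReal.toReal_eq_toReal_iff' (measure_ne_top _ _)
        (ENNReal.prod_ne_top fun i _ => measure_ne_top _ _), ENNReal.toReal_prod]
      exact hmain
  rw [iIndepFun_iff_iIndep]
  refine iIndepSets.iIndep (fun i => (hX.measurable i).comap_le)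
    (fun i => preimage (X i) '' range Iic) (fun i => ?_) (fun i => ?_) ?_
  · exact isPiSystem_Iic.comap (X i)
  · rw [BorelSpace.measurable_eq (α := ℝ), borel_eq_generateFrom_Iic,
      MeasurableSpace.comap_generateFrom]
  · rw [iIndepSets_iff]
    intro s f hf
    have : ∀ i, ∃ y, i ∈ s → X i ⁻¹' Iic y = f i := by
      intro i
      by_cases hi : i ∈ s
      · obtain ⟨_, ⟨y, rfl⟩, hy⟩ := hf i hi
        exact ⟨y, fun _ => hy⟩
      · exact ⟨0, fun h => absurd h hi⟩
    choose y hy using this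
    rw [Finset.prod_congr rfl fun i hi => congrArg P (hy i hi).symm, ← hIic]
    congr 1
    exact iInter₂_congr fun i hi => (hy i hi).symm

end IsMetaArchimedean

/-! ### Nondegenerate limits and convergence of distribution functions -/

/-- A law on `ℝ` that is not a point mass has a continuity point at which its distribution
function is neither `0` nor `1`. -/
theorem exists_continuity_point_cdf_mem_Ioo (G : Measure ℝ) [IsProbabilityMeasure G]
    (hG : ∀ a : ℝ, G ≠ Measure.dirac a) : ∃ x, G {x} = 0 ∧ cdf G x ∈ Ioo (0 : ℝ) 1 := by
  by_contra! hcon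
  have hatoms : {x | 0 < G {x}}.Countable :=
    Measure.countable_meas_pos_of_disjoint_iUnion (fun x => measurableSet_singleton x)
      (fun x y hxy => by simpa using hxy)
  have hdense : Dense {x | 0 < G {x}}ᶜ := hatoms.dense_compl ℝ
  -- If `0 < cdf G x < 1`, right continuity keeps the values below 1 just to the right of `x`, where
  -- there is a non-atom because atoms are countable.
  have h01 : ∀ x, cdf G x = 0 ∨ cdf G x = 1 := by
    intro x
    by_contra! hx
    have hx1 : cdf G x < 1 := lt_of_le_of_ne (cdf_le_one G x) hx.2
    have hx0 : 0 < cdf G x := lt_of_le_of_ne (cdf_nonneg G x) hx.1.symm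
    have hev : ∀ᶠ y in 𝓝[≥] x, cdf G y < 1 :=
      ((cdf G).right_continuous x).eventually (gt_mem_nhds hx1)
    obtain ⟨b, hb, hsub⟩ := (mem_nhdsGE_iff_exists_Ico_subset).1 hev
    obtain ⟨y, hy, hyb⟩ := hdense.exists_between (mem_Ioi.1 hb)
    exact hcon y (by simpa using hy)
      ⟨hx0.trans_le (monotone_cdf G hyb.1.le), hsub ⟨hyb.1.le, hyb.2⟩⟩
  obtain ⟨b, hb⟩ := ((tendsto_cdf_atTop G).eventually (lt_mem_nhds zero_lt_one)).exists
  obtain ⟨l, hl⟩ := ((tendsto_cdf_atBot G).eventually (gt_mem_nhds zero_lt_one)).exists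
  have hne : {x | cdf G x = 1}.Nonempty := ⟨b, (h01 b).resolve_left hb.ne'⟩
  have hbdd : BddBelow {x | cdf G x = 1} := by
    refine ⟨l, fun x hx => ?_⟩
    by_contra! hlt
    have h1 : cdf G x = 1 := hx
    linarith [monotone_cdf G hlt.le]
  set a := sInf {x | cdf G x = 1}
  have hgt : ∀ x, a < x → cdf G x = 1 := by
    intro x hx
    obtain ⟨y, hy, hyx⟩ := exists_lt_of_csInf_lt hne hx
    have h1 : cdf G y = 1 := hy
    exact le_antisymm (cdf_le_one G x) (h1 ▸ monotone_cdf G hyx.le)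
  have ha : cdf G a = 1 := by
    have h1 : Tendsto (cdf G) (𝓝[>] a) (𝓝 (cdf G a)) :=
      ((cdf G).right_continuous a).mono_left (nhdsWithin_mono _ Ioi_subset_Ici_self)
    refine tendsto_nhds_unique h1 (tendsto_const_nhds.congr' ?_)
    filter_upwards [self_mem_nhdsWithin] with x hx using (hgt x hx).symm
  refine hG a (Measure.eq_of_cdf _ _ ?_)
  ext x
  rw [cdf_eq_real (Measure.dirac a)]
  rcases lt_or_ge x a with hx | hx
  · have : cdf G x ≠ 1 := fun h => notMem_of_lt_csInf hx hbdd h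
    simp [Measure.real, (h01 x).resolve_right this, hx]
  · have : cdf G x = 1 := le_antisymm (cdf_le_one G x) (ha ▸ monotone_cdf G hx)
    simp [Measure.real, this, hx]

/-- Convergence in distribution gives convergence of the distribution functions at the continuity
points of the limit. -/
theorem MeasureTheory.TendstoInDistribution.tendsto_measureReal_le {Ω : Type*} [MeasurableSpace Ω]
    {P : Measure Ω} [IsProbabilityMeasure P] {G : Measure ℝ} [IsProbabilityMeasure G]
    {Y : ℕ → Ω → ℝ} (h : TendstoInDistribution Y atTop (id : ℝ → ℝ) (fun _ => P) G)
    {x : ℝ} (hx : G {x} = 0) :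
    Tendsto (fun n => P.real {ω | Y n ω ≤ x}) atTop (𝓝 (cdf G x)) := by
  have h1 := ProbabilityMeasure.tendsto_measure_of_null_frontier_of_tendsto' h.tendsto
    (E := Iic x) (by simpa using hx)
  rw [ProbabilityMeasure.coe_mk, Measure.map_id] at h1
  have h2 := (ENNReal.tendsto_toReal (measure_ne_top G _)).comp h1
  convert! h2 using 2
  · rename_i n
    simp only [Function.comp, ProbabilityMeasure.coe_mk]
    rw [Measure.map_apply_of_aemeasurable (h.forall_aemeasurable n) measurableSet_Iic]
    rfl
  · simp [cdf_eq_real, Measure.real]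

/-! ### Independence implies mixing -/

namespace IsIIDSequence

variable {Ω : Type*} [MeasurableSpace Ω] {P : Measure Ω}
  {X : ℕ → Ω → ℝ}

theorem isStrictlyStationary (hm : ∀ i, Measurable (X i)) (h : IsIIDSequence P X) :
    IsStrictlyStationary P X := by
  have h1 : iIndepFun (fun i => X (i + 1)) P := h.1.precomp (add_left_injective 1)
  rw [IsStrictlyStationary, h1.map_fun_eq_infinitePi_map fun i => hm (i + 1),
    h.1.map_fun_eq_infinitePi_map hm]
  congr 1
  funext i
  rw [(h.2 (i + 1)).map_eq, (h.2 i).map_eq]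

theorem distributionalMixing [IsProbabilityMeasure P]
    (hm : ∀ i, Measurable (X i)) (h : IsIIDSequence P X) (u : ℕ → ℝ) :
    DistributionalMixing P X u := by
  refine ⟨h.isStrictlyStationary hm, fun _ _ => 0, fun _ => 1, ?_, fun _ => one_pos, ?_,
    tendsto_const_nhds⟩
  · intro n l A B hA hB _ _ hAB
    have hprod : ∀ C : Finset ℕ, C.Nonempty → P.real {ω | maxOver X C ω ≤ u n} =
        ∏ i ∈ C, P.real (X i ⁻¹' Iic (u n)) := by
      intro C hC
      have hset : {ω | maxOver X C ω ≤ u n} = ⋂ i ∈ C, X i ⁻¹' Iic (u n) := by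
        ext ω
        simp [maxOver, hC]
      rw [hset, Measure.real,
        h.1.measure_inter_preimage_eq_mul C (fun _ _ => measurableSet_Iic), ENNReal.toReal_prod]
      rfl
    have hdisj : Disjoint A B := Finset.disjoint_left.2 fun i hi hi' =>
      absurd (hAB i hi i hi').1 (lt_irrefl i)
    rw [hprod _ (hA.mono Finset.subset_union_left), hprod A hA, hprod B hB,
      Finset.prod_union hdisj, sub_self, abs_zero]
  · simpa using tendsto_one_div_atTop_nhds_zero_nat (𝕜 := ℝ)

end IsIIDSequence

theorem tendsto_natDiv_div_atTop {m : ℕ} (hm : m ≠ 0) :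
    Tendsto (fun n : ℕ => ((n / m : ℕ) : ℝ) / n) atTop (𝓝 (1 / m)) := by
  have h := (tendsto_nat_floor_mul_div_atTop (R := ℝ) (a := 1 / m) (by positivity)).comp
    tendsto_natCast_atTop_atTop
  refine h.congr fun n => ?_
  simp only [Function.comp]
  rw [one_div_mul_eq_div, Nat.floor_div_eq_div]

/-! ### Mixing implies an exponential generator -/

namespace IsMetaArchimedean

variable {Ω : Type*} [MeasurableSpace Ω] {P : Measure Ω}
  {X : ℕ → Ω → ℝ} {ψ : ℝ → ℝ} {u : ℕ → ℝ} {τ : ℝ}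

theorem continuousAt_generator (hX : IsMetaArchimedean P X ψ) {t : ℝ} (ht : 0 < t) :
    ContinuousAt ψ t :=
  hX.generator.continuousOn.continuousAt (Ici_mem_nhds ht)

/-- If the distribution function of the maximum along `u` converges to `ψ τ`, then
`ψ⁻¹(F (u n)) ~ τ / n`. -/
theorem exists_tendsto_natCast_mul [IsProbabilityMeasure P]
    (hX : IsMetaArchimedean P X ψ) (hτ : 0 < τ)
    (hlim : Tendsto (fun n => P.real {ω | ∀ i ∈ Finset.range n, X i ω ≤ u n}) atTop (𝓝 (ψ τ))) :
    ∃ t : ℕ → ℝ, (∀ n, 0 ≤ t n) ∧ (∀ᶠ n in atTop, cdf (P.map (X 0)) (u n) = ψ (t n)) ∧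
      Tendsto (fun n : ℕ => n * t n) atTop (𝓝 τ) := by
  have hF : ∀ᶠ n in atTop, 0 < cdf (P.map (X 0)) (u n) := by
    filter_upwards [hlim.eventually (lt_mem_nhds (hX.generator_pos hτ.le)), eventually_ge_atTop 1]
      with n hn hn1
    rw [← hX.measureReal_le 0]
    exact hn.trans_le (measureReal_mono fun ω hω => hω 0 (Finset.mem_range.2 hn1))
  have hex : ∀ n, ∃ t, 0 ≤ t ∧
      (0 < cdf (P.map (X 0)) (u n) → cdf (P.map (X 0)) (u n) = ψ t) := by
    intro n
    by_cases h : 0 < cdf (P.map (X 0)) (u n)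
    · obtain ⟨t, ht, h'⟩ := hX.generator.exists_eq h (cdf_le_one _ _)
      exact ⟨t, ht, fun _ => h'.symm⟩
    · exact ⟨0, le_rfl, fun h' => absurd h' h⟩
  choose t ht0 ht using hex
  have htF : ∀ᶠ n in atTop, cdf (P.map (X 0)) (u n) = ψ (t n) := hF.mono fun n hn => ht n hn
  have hlim' : Tendsto (fun n : ℕ => ψ (n * t n)) atTop (𝓝 (ψ τ)) := by
    refine hlim.congr' (htF.mono fun n hn => ?_)
    rw [hX.measureReal_forall_le_const _ (ht0 n) hn, Finset.card_range]
  have hnt : ∀ n : ℕ, (n : ℝ) * t n ∈ Ici (0 : ℝ) := fun n =>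
    mem_Ici.2 (mul_nonneg n.cast_nonneg (ht0 n))
  -- Strict monotonicity of `ψ` transfers order bounds from `ψ (n * t n)` back to `n * t n`.
  refine ⟨t, ht0, htF, tendsto_order.2 ⟨fun a ha => ?_, fun b hb => ?_⟩⟩
  · rcases lt_or_ge a 0 with h | h
    · exact Eventually.of_forall fun n => h.trans_le (hnt n)
    · filter_upwards [hlim'.eventually (gt_mem_nhds (hX.strictAntiOn h hτ.le ha))] with n hn
      exact (hX.strictAntiOn.lt_iff_gt (hnt n) h).1 hn
  · filter_upwards [hlim'.eventually (lt_mem_nhds (hX.strictAntiOn hτ.le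
      (hτ.trans hb).le hb))] with n hn
    exact (hX.strictAntiOn.lt_iff_gt (hτ.trans hb).le (hnt n)).1 hn

/-- Mixing along levels with a nondegenerate limit makes the generator multiplicative. -/
theorem generator_two_mul_div [IsProbabilityMeasure P]
    (hX : IsMetaArchimedean P X ψ) (hu : DistributionalMixing P X u)
    (hτ : 0 < τ)
    (hlim : Tendsto (fun n => P.real {ω | ∀ i ∈ Finset.range n, X i ω ≤ u n}) atTop (𝓝 (ψ τ)))
    {m : ℕ} (hm : 3 ≤ m) : ψ (2 * (τ / m)) = ψ (τ / m) ^ 2 := by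
  obtain ⟨t, ht0, htF, hnt⟩ := hX.exists_tendsto_natCast_mul hτ hlim
  obtain ⟨α, s, hmix, hs0, hs, hα⟩ := hu.mixing
  have hm0 : (0 : ℝ) < m := by
    exact_mod_cast (by omega : 0 < m)
  have hdiv := tendsto_natDiv_div_atTop (m := m) (by omega)
  have hkt : Tendsto (fun n : ℕ => ((n / m : ℕ) : ℝ) * t n) atTop (𝓝 (τ / m)) := by
    have h := hdiv.mul hnt
    rw [one_div_mul_eq_div] at h
    refine h.congr' ?_
    filter_upwards [eventually_gt_atTop 0] with n hn
    field_simp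
  have hsk : ∀ᶠ n in atTop, s n ≤ n / m := by
    filter_upwards [hs.eventually_lt hdiv (by positivity), eventually_gt_atTop 0] with n hn hn0
    have hn0' : (0 : ℝ) < n := by exact_mod_cast hn0
    rw [div_lt_div_iff_of_pos_right hn0'] at hn
    exact_mod_cast hn.le
  have hbound : ∀ᶠ n : ℕ in atTop,
      |ψ (2 * (((n / m : ℕ) : ℝ) * t n)) - ψ (((n / m : ℕ) : ℝ) * t n) ^ 2| ≤ α n (s n) := by
    filter_upwards [hsk, htF] with n hn hF
    -- The blocks are the first and last `k` indices below `n`. As `m ≥ 3`, the `n - 2 * k` indices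
    -- between them number at least `k ≥ s n`.
    set k := n / m with hk
    have hk3 : 3 * k ≤ n := (Nat.mul_le_mul_right k hm).trans (Nat.mul_div_le n m)
    have hk0 : 0 < k := (hs0 n).trans_le hn
    have hA : (Finset.range k).Nonempty := ⟨0, Finset.mem_range.2 hk0⟩
    have hB : (Finset.Ico (n - k) n).Nonempty := ⟨n - k, Finset.mem_Ico.2 (by omega)⟩
    have hgap : ∀ i ∈ Finset.range k, ∀ j ∈ Finset.Ico (n - k) n, i < j ∧ i + s n ≤ j := by
      intro i hi j hj
      rw [Finset.mem_range] at hi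
      rw [Finset.mem_Ico] at hj
      omega
    have hdisj : Disjoint (Finset.range k) (Finset.Ico (n - k) n) :=
      Finset.disjoint_left.2 fun i hi hj => lt_irrefl i (hgap i hi i hj).1
    have h := hmix n (s n) _ _ hA hB (Finset.range_mono (by omega))
      (fun i hi => Finset.mem_range.2 (Finset.mem_Ico.1 hi).2) hgap
    rw [setOf_maxOver_le hA, setOf_maxOver_le hB,
      setOf_maxOver_le (hA.mono Finset.subset_union_left),
      hX.measureReal_forall_le_const _ (ht0 n) hF, hX.measureReal_forall_le_const _ (ht0 n) hF,
      hX.measureReal_forall_le_const _ (ht0 n) hF, Finset.card_union_of_disjoint hdisj,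
      Finset.card_range, Nat.card_Ico, Nat.sub_sub_self (by omega)] at h
    convert! h using 3
    · push_cast
      ring_nf
    · ring
  have hpos : 0 < τ / m := by positivity
  have h1 := (hX.continuousAt_generator (t := 2 * (τ / m)) (by positivity)).tendsto.comp
    (hkt.const_mul 2)
  have h2 := ((hX.continuousAt_generator hpos).tendsto.comp hkt).pow 2
  have h3 := le_of_tendsto_of_tendsto (h1.sub h2).abs hα hbound
  exact sub_eq_zero.1 (abs_nonpos_iff.1 h3)

/-- A generator that is multiplicative along `τ / m` for all `m ≥ 3` is exponential. -/
theorem generator_eq_rpow [IsProbabilityMeasure P]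
    (hX : IsMetaArchimedean P X ψ) (hτ : 0 < τ)
    (h : ∀ m : ℕ, 3 ≤ m → ψ (2 * (τ / m)) = ψ (τ / m) ^ 2) {t : ℝ} (ht : 0 ≤ t) :
    ψ t = (ψ τ ^ τ⁻¹) ^ t := by
  have hg : 0 < ψ τ := hX.generator_pos hτ.le
  have hrat : ∀ m : ℕ, 3 ≤ m → ∀ k : ℕ, ψ (k * (τ / m)) = ψ τ ^ ((k : ℝ) / m) := by
    intro m hm k
    have hm0 : (0 : ℝ) < m := by
      exact_mod_cast (by omega : 0 < m)
    have hpos : 0 < τ / m := by positivity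
    have hpow := hX.generator_natCast_mul hpos (h m hm)
    have hroot : ψ (τ / m) = ψ τ ^ ((m : ℝ)⁻¹) := by
      have := hpow m
      rw [mul_div_cancel₀ _ hm0.ne'] at this
      rw [this, Real.pow_rpow_inv_natCast (hX.generator_pos hpos.le).le (by omega)]
    rw [hpow, hroot, ← Real.rpow_mul_natCast hg.le, inv_mul_eq_div]
  rw [← Real.rpow_mul hg.le, inv_mul_eq_div]
  rcases ht.eq_or_lt with rfl | ht
  · simp [hX.generator.map_zero]
  -- `t / τ` is approximated by the fractions `⌊(t / τ) * n⌋ / n`, at which `hrat` applies.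
  have hfloor := (tendsto_nat_floor_mul_div_atTop (R := ℝ) (a := t / τ) (by positivity)).comp
    tendsto_natCast_atTop_atTop
  have h1 : Tendsto (fun n : ℕ => ψ (((⌊t / τ * n⌋₊ : ℝ) / n) * τ)) atTop (𝓝 (ψ t)) := by
    have h2 := hfloor.mul_const τ
    rw [div_mul_cancel₀ _ hτ.ne'] at h2
    exact (hX.continuousAt_generator ht).tendsto.comp h2
  refine tendsto_nhds_unique h1 (Tendsto.congr' ?_
    (((Real.continuousAt_const_rpow hg.ne').tendsto).comp hfloor))
  filter_upwards [eventually_ge_atTop 3] with n hn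
  simp only [Function.comp]
  rw [← hrat n hn]
  ring_nf

end IsMetaArchimedean

/-- `G` is the limit law of the normalized maxima `(Mₙ - dₙ) / cₙ`, where
`Mₙ = maxOver X (Finset.range n)`; it is nondegenerate, i.e. not a point mass. -/
theorem mainTheorem11 {Ω : Type*} [MeasurableSpace Ω] (P : Measure Ω) [IsProbabilityMeasure P]
    (X : ℕ → Ω → ℝ) (ψ : ℝ → ℝ) (hX : IsMetaArchimedean P X ψ)
    (ρ : ℝ) (hρ : ρ ∈ Set.Ioc (0 : ℝ) 1)
    (hψ : IsRegularlyVarying (fun x => 1 - ψ (1 / x)) (-ρ))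
    (c d : ℕ → ℝ) (hc : ∀ n, 0 < c n)
    (G : Measure ℝ) [IsProbabilityMeasure G] (hG : ∀ a : ℝ, G ≠ Measure.dirac a)
    (hlim : TendstoInDistribution
      (fun n ω => (maxOver X (Finset.range n) ω - d n) / c n) atTop
      (id : ℝ → ℝ) (fun _ => P) G) :
    (∀ x : ℝ, DistributionalMixing P X (fun n => c n * x + d n)) ↔ IsIIDSequence P X := by
  refine ⟨fun hmix => ?_, fun h x => h.distributionalMixing hX.measurable _⟩
  -- This single `x` is the only level at which mixing is needed.
  obtain ⟨x, hx0, hx⟩ := exists_continuity_point_cdf_mem_Ioo G hG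
  obtain ⟨τ, hτ, hτx⟩ := hX.generator.exists_eq hx.1 hx.2.le
  have hτ0 : 0 < τ := by
    refine lt_of_le_of_ne hτ fun h => hx.2.ne ?_
    rw [← hτx, ← h, hX.generator.map_zero]
  have hmax : Tendsto (fun n => P.real {ω | ∀ i ∈ Finset.range n, X i ω ≤ c n * x + d n}) atTop
      (𝓝 (ψ τ)) := by
    rw [hτx]
    refine (hlim.tendsto_measureReal_le hx0).congr' ?_
    -- At `n = 0` the maximum is the default value 0, so that index is discarded.
    filter_upwards [eventually_gt_atTop 0] with n hn
    rw [← setOf_maxOver_le ⟨0, Finset.mem_range.2 hn⟩]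
    congr 1
    ext ω
    simp only [mem_ofPred_eq]
    rw [div_le_iff₀ (hc n), sub_le_iff_le_add, mul_comm x]
  refine ⟨hX.iIndepFun_of_generator_eq (Real.rpow_pos_of_pos (hX.generator_pos hτ) τ⁻¹)
    fun t ht => hX.generator_eq_rpow hτ0 (fun m hm => ?_) ht, hX.identDistrib⟩
  exact hX.generator_two_mul_div (hmix x) hτ0 hmax hm
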